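/- Let $k$ be a field. A *layered weak ditalgebra* $\mathcal A=(T,\delta)$ with layer $(R,W)$ consists of a $k$-algebra $T=T_R(W_0\oplus W_1)$ which is the tensor algebra of an $R$-$R$-bimodule $W=W_0\oplus W_1$ over a $k$-algebra $R$ ($k$ acting centrally), graded by giving $R,W_0$ degree $0$ and $W_1$ degree $1$, together with a $k$-linear map $\delta:T\to T$ of degree $1$ with $\delta(ab)=\delta(a)b+(-1)^{\deg a}a\delta(b)$ for $a$ homogeneous and $\delta(R)=0$. Put $A=[T]_0=T_R(W_0)$ and $V=[T]_1=AW_1A$. An *interlaced weak ditalgebra* $\underline{\mathcal A}=(\mathcal A,I)$ is a layered weak ditalgebra with a two-sided ideal $I$ of $A$ such that $\delta(I)\subseteq IV+VI$, $\delta^2(A)\subseteq IV^2+VIV+V^2I$ and $\delta^2(V)\subseteq IV^3+VIV^2+V^2IV+V^3I$. It is *triangular* if there are finite filtrations by $R$-$R$-subbimodules $0=W_0^0\subseteq\cdots\subseteq W_0^r=W_0$ and $0=W_1^0\subseteq\cdots\subseteq W_1^s=W_1$ with $\delta(W_0^{i+1})\subseteq A_iW_1A_i$ for $0\le i<r$,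 where $A_i$ is the subalgebra generated by $R$ and $W_0^i$, and $\delta(W_1^{i+1})\subseteq AW_1^iAW_1^iA$ for $0\le i<s$. The category $\underline{\mathcal A}\text{-}\mathrm{Mod}$ has as objects the $A$-modules annihilated by $I$. A morphism $M\to N$ is a pair $(f^0,f^1)$ with $f^0\in\mathrm{Hom}_R(M,N)$ and $f^1:V\to\mathrm{Hom}_k(M,N)$ a morphism of $A$-$A$-bimodules such that $af^0(m)=f^0(am)+f^1(\delta(a))(m)$ for all $a\in A$, $m\in M$; composition is given by $(gf)^0=g^0f^0$ and $(gf)^1(v)=g^0f^1(v)+g^1(v)f^0+\sum_i g^1(u_i)f^1(w_i)$ if $\delta(v)=\sum_i u_iw_i$ with $u_i,w_i\in V$. The *endolength* of $M$ is the length of $M$ as a right module over $\mathrm{End}_{\underline{\mathcal A}}(M)^{op}$, where $m\cdot(f^0,f^1)=f^0(m)$. The module $M$ is *pregeneric* if it is indecomposable in $\underline{\mathcal A}\text{-}\mathrm{Mod}$, has finite endolength and has infinite dimension over $k$. We call $\underline{\mathcal A}$ *pregenerically tame* if for each $d\in\mathbb N$ there are only finitely many isomorphism classes of pregeneric $\underline{\mathcal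 A}$-modules of endolength $d$. We call $\underline{\mathcal A}$ *wild* if there is an $A/I$-$k\langle x,y\rangle$-bimodule $Z$, free of finite rank as a right $k\langle x,y\rangle$-module, such that the composition of $Z\otimes_{k\langle x,y\rangle}-:k\langle x,y\rangle\text{-}\mathrm{Mod}\to A/I\text{-}\mathrm{Mod}$ with the canonical embedding $A/I\text{-}\mathrm{Mod}\to\underline{\mathcal A}\text{-}\mathrm{Mod}$, $f^0\mapsto(f^0,0)$, maps indecomposable modules to indecomposable ones and non-isomorphic indecomposable modules to non-isomorphic ones. **Proposition.** Any pregenerically tame triangular interlaced weak ditalgebra $\underline{\mathcal A}$ over $k$ is not wild. -/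

import Mathlib

open CategoryTheory CategoryTheory.Limits
open scoped TensorProduct

universe u

/-! ## Layered tensor algebras -/

/-- A `k`-algebra `T` together with a layer `(R, W)`: a subalgebra `R`, an `R`-`R`-bimodule
`W = W₀ ⊕ W₁`, such that `T` is freely generated by `(R, W)`, i.e. `T` is the tensor algebra
`T_R(W₀ ⊕ W₁)`. This is expressed by the universal property of the tensor algebra
(which forces the sum `W₀ + W₁` to be direct). -/
structure LayeredTensorAlgebra (k T : Type u) [Field k] [Ring T] [Algebra k T] where
  /-- the subalgebra `R` -/
  R : Subalgebra k T
  /-- the part of degree zero of `W` -/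
  W₀ : Submodule k T
  /-- the part of degree one of `W` -/
  W₁ : Submodule k T
  left_mem₀ : ∀ r ∈ R, ∀ w ∈ W₀, r * w ∈ W₀
  right_mem₀ : ∀ r ∈ R, ∀ w ∈ W₀, w * r ∈ W₀
  left_mem₁ : ∀ r ∈ R, ∀ w ∈ W₁, r * w ∈ W₁
  right_mem₁ : ∀ r ∈ R, ∀ w ∈ W₁, w * r ∈ W₁
  /-- Every algebra morphism `φ : R → B` and every pair of morphisms of `R`-`R`-bimodules
  `W₀ → B`, `W₁ → B` extend uniquely to an algebra morphism `T → B`. -/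
  free : ∀ (B : Type u) [Ring B] [Algebra k B] (φ : R →ₐ[k] B)
    (ψ₀ : W₀ →ₗ[k] B) (ψ₁ : W₁ →ₗ[k] B),
    (∀ (r : R) (w : W₀), ψ₀ ⟨r * w, left_mem₀ r r.2 w w.2⟩ = φ r * ψ₀ w) →
    (∀ (r : R) (w : W₀), ψ₀ ⟨w * r, right_mem₀ r r.2 w w.2⟩ = ψ₀ w * φ r) →
    (∀ (r : R) (w : W₁), ψ₁ ⟨r * w, left_mem₁ r r.2 w w.2⟩ = φ r * ψ₁ w) →
    (∀ (r : R) (w : W₁), ψ₁ ⟨w * r, right_mem₁ r r.2 w w.2⟩ = ψ₁ w * φ r) →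
    ∃! Φ : T →ₐ[k] B, (∀ r : R, Φ r = φ r) ∧ (∀ w : W₀, Φ w = ψ₀ w) ∧ (∀ w : W₁, Φ w = ψ₁ w)

namespace LayeredTensorAlgebra

variable {k T : Type u} [Field k] [Ring T] [Algebra k T]

/-- `A = [T]₀ = T_R(W₀)`, the subalgebra generated by `R` and `W₀`. -/
def A (L : LayeredTensorAlgebra k T) : Subalgebra k T :=
  Algebra.adjoin k ((L.R : Set T) ∪ (L.W₀ : Set T))

/-- `V = [T]₁ = A W₁ A`. -/
def V (L : LayeredTensorAlgebra k T) : Submodule k T :=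
  L.A.toSubmodule * L.W₁ * L.A.toSubmodule

/-- The homogeneous component `[T]ₙ`, where `R` and `W₀` have degree zero and `W₁` has degree
one: `[T]₀ = A` and `[T]ₙ = Vⁿ` for `n ≥ 1`. -/
def grade (L : LayeredTensorAlgebra k T) : ℕ → Submodule k T
  | 0 => L.A.toSubmodule
  | n + 1 => L.V ^ (n + 1)

variable (L : LayeredTensorAlgebra k T)

theorem toSubmodule_mul_self (S : Subalgebra k T) :
    S.toSubmodule * S.toSubmodule = S.toSubmodule :=
  le_antisymm (Submodule.mul_le.2 fun _ ha _ hb => S.mul_mem ha hb) fun a ha => by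
    simpa using Submodule.mul_mem_mul ha (show (1 : T) ∈ S.toSubmodule from S.one_mem)

theorem lmul_mem {a v : T} (ha : a ∈ L.A) (hv : v ∈ L.V) : a * v ∈ L.V := by
  have h : L.A.toSubmodule * L.V = L.V := by
    rw [V, ← mul_assoc, ← mul_assoc, toSubmodule_mul_self]
  rw [← h]
  exact Submodule.mul_mem_mul ha hv

theorem rmul_mem {a v : T} (ha : a ∈ L.A) (hv : v ∈ L.V) : v * a ∈ L.V := by
  have h : L.V * L.A.toSubmodule = L.V := by
    rw [V, mul_assoc, toSubmodule_mul_self]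
  rw [← h]
  exact Submodule.mul_mem_mul hv ha

theorem R_le_A {r : T} (hr : r ∈ L.R) : r ∈ L.A := Algebra.subset_adjoin (Or.inl hr)

theorem W₀_le_A {w : T} (hw : w ∈ L.W₀) : w ∈ L.A := Algebra.subset_adjoin (Or.inr hw)

theorem W₁_le_V {w : T} (hw : w ∈ L.W₁) : w ∈ L.V := by
  have h1 : (1 : T) ∈ L.A.toSubmodule := L.A.one_mem
  simpa [V] using Submodule.mul_mem_mul (Submodule.mul_mem_mul h1 hw) h1

/-- The left action of `A` on `V`. -/
def lmul (a : L.A) (v : L.V) : L.V := ⟨a * v, L.lmul_mem a.2 v.2⟩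

/-- The right action of `A` on `V`. -/
def rmul (v : L.V) (a : L.A) : L.V := ⟨v * a, L.rmul_mem a.2 v.2⟩

/-- `T` is freely generated by `(A, V)`. -/
theorem exists_lift {B : Type u} [Ring B] [Algebra k B] (φ : L.A →ₐ[k] B) (ψ : L.V →ₗ[k] B)
    (hl : ∀ a v, ψ (L.lmul a v) = φ a * ψ v) (hr : ∀ a v, ψ (L.rmul v a) = ψ v * φ a) :
    ∃ Φ : T →ₐ[k] B, (∀ a : L.A, Φ a = φ a) ∧ ∀ v : L.V, Φ v = ψ v := by
  obtain ⟨Φ, ⟨hR, h0, h1⟩, -⟩ := L.free B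
    (φ.comp (Subalgebra.inclusion fun _ h => L.R_le_A h))
    (φ.toLinearMap ∘ₗ Submodule.inclusion (p' := L.A.toSubmodule) fun _ h => L.W₀_le_A h)
    (ψ ∘ₗ Submodule.inclusion fun _ h => L.W₁_le_V h)
    (fun r w => map_mul φ ⟨r, L.R_le_A r.2⟩ ⟨w, L.W₀_le_A w.2⟩)
    (fun r w => map_mul φ ⟨w, L.W₀_le_A w.2⟩ ⟨r, L.R_le_A r.2⟩)
    (fun r w => hl ⟨r, L.R_le_A r.2⟩ ⟨w, L.W₁_le_V w.2⟩)
    (fun r w => hr ⟨r, L.R_le_A r.2⟩ ⟨w, L.W₁_le_V w.2⟩)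
  have hA : ∀ (a : T) (ha : a ∈ L.A), Φ a = φ ⟨a, ha⟩ := by
    intro a ha
    induction ha using Algebra.adjoin_induction with
    | mem x hx =>
      rcases hx with hx | hx
      · exact hR ⟨x, hx⟩
      · exact h0 ⟨x, hx⟩
    | algebraMap c =>
      rw [AlgHom.commutes]
      exact (φ.commutes c).symm
    | add x y hx hy h h' =>
      rw [map_add, h, h', ← map_add]
      rfl
    | mul x y hx hy h h' =>
      rw [map_mul, h, h', ← map_mul]
      rfl
  refine ⟨Φ, fun a => hA a a.2, ?_⟩
  rintro ⟨v, hv⟩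
  change Φ v = _
  have key : ∀ x ∈ L.A.toSubmodule * L.W₁, ∃ hx : x ∈ L.V, Φ x = ψ ⟨x, hx⟩ := by
    intro x hx
    induction hx using Submodule.mul_induction_on' with
    | mem_mul_mem a ha w hw =>
      refine ⟨L.lmul_mem ha (L.W₁_le_V hw), ?_⟩
      rw [map_mul, hA a ha, h1 ⟨w, hw⟩]
      exact (hl ⟨a, ha⟩ ⟨w, L.W₁_le_V hw⟩).symm
    | add x hx y hy h h' =>
      obtain ⟨m, e⟩ := h
      obtain ⟨m', e'⟩ := h'
      refine ⟨L.V.add_mem m m', ?_⟩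
      rw [map_add, e, e', ← map_add]
      rfl
  have key2 : ∀ x ∈ L.A.toSubmodule * L.W₁ * L.A.toSubmodule,
      ∃ hx : x ∈ L.V, Φ x = ψ ⟨x, hx⟩ := by
    intro x hx
    induction hx using Submodule.mul_induction_on' with
    | mem_mul_mem w hw a ha =>
      obtain ⟨m, e⟩ := key w hw
      refine ⟨L.rmul_mem ha m, ?_⟩
      rw [map_mul, hA a ha, e]
      exact (hr ⟨a, ha⟩ ⟨w, m⟩).symm
    | add x hx y hy h h' =>
      obtain ⟨m, e⟩ := h
      obtain ⟨m', e'⟩ := h'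
      refine ⟨L.V.add_mem m m', ?_⟩
      rw [map_add, e, e', ← map_add]
      rfl
  obtain ⟨_, e⟩ := key2 v hv
  exact e

end LayeredTensorAlgebra

/-! ## Interlaced weak ditalgebras -/

/-- A weak ditalgebra `(T, δ)` with layer `(R, W)`: `δ` is a `k`-linear map of degree one which
satisfies the graded Leibniz rule and vanishes on `R` (it is not assumed that `δ² = 0`). -/
structure WeakDitalgebra (k T : Type u) [Field k] [Ring T] [Algebra k T] extends
    LayeredTensorAlgebra k T where
  /-- the derivation -/
  δ : T →ₗ[k] T
  δ_mem : ∀ (n : ℕ) (t : T), t ∈ toLayeredTensorAlgebra.grade n →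
    δ t ∈ toLayeredTensorAlgebra.grade (n + 1)
  leibniz : ∀ (n : ℕ) (s t : T), s ∈ toLayeredTensorAlgebra.grade n →
    δ (s * t) = δ s * t + (-1) ^ n * (s * δ t)
  δ_R : ∀ r ∈ R, δ r = 0

/-- The layer `(R, W)` is triangular. Here `Algebra.adjoin k (R ∪ F i)` is the subalgebra `Aᵢ`
generated by `R` and the `i`-th term `F i` of the filtration of `W₀`. -/
structure WeakDitalgebra.IsTriangular {k T : Type u} [Field k] [Ring T] [Algebra k T]
    (𝒜 : WeakDitalgebra k T) : Prop where
  filtration₀ : ∃ (r : ℕ) (F : ℕ → Submodule k T), Monotone F ∧ F 0 = ⊥ ∧ F r = 𝒜.W₀ ∧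
    (∀ i, ∀ x ∈ 𝒜.R, ∀ w ∈ F i, x * w ∈ F i ∧ w * x ∈ F i) ∧
    ∀ i < r, ∀ w ∈ F (i + 1), 𝒜.δ w ∈
      (Algebra.adjoin k ((𝒜.R : Set T) ∪ (F i : Set T))).toSubmodule * 𝒜.W₁ *
        (Algebra.adjoin k ((𝒜.R : Set T) ∪ (F i : Set T))).toSubmodule
  filtration₁ : ∃ (s : ℕ) (F : ℕ → Submodule k T), Monotone F ∧ F 0 = ⊥ ∧ F s = 𝒜.W₁ ∧
    (∀ i, ∀ x ∈ 𝒜.R, ∀ w ∈ F i, x * w ∈ F i ∧ w * x ∈ F i) ∧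
    ∀ i < s, ∀ w ∈ F (i + 1), 𝒜.δ w ∈
      𝒜.A.toSubmodule * F i * 𝒜.A.toSubmodule * F i * 𝒜.A.toSubmodule

/-- An interlaced weak ditalgebra `(𝒜, I)`: `I` is a two-sided ideal of `A` with
`δ(I) ⊆ IV + VI`, `δ²(A) ⊆ IV² + VIV + V²I` and `δ²(V) ⊆ IV³ + VIV² + V²IV + V³I`. -/
structure InterlacedWeakDitalgebra (k T : Type u) [Field k] [Ring T] [Algebra k T] extends
    WeakDitalgebra k T where
  /-- the ideal -/
  I : Ideal toLayeredTensorAlgebra.A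
  twoSided : I.IsTwoSided
  δ_I : ∀ a ∈ I, δ a ∈
    (I.restrictScalars k).map toLayeredTensorAlgebra.A.val.toLinearMap *
      toLayeredTensorAlgebra.V ⊔
    toLayeredTensorAlgebra.V *
      (I.restrictScalars k).map toLayeredTensorAlgebra.A.val.toLinearMap
  δδ_A : ∀ a ∈ toLayeredTensorAlgebra.A, δ (δ a) ∈
    (I.restrictScalars k).map toLayeredTensorAlgebra.A.val.toLinearMap *
      toLayeredTensorAlgebra.V ^ 2 ⊔
    toLayeredTensorAlgebra.V *
      (I.restrictScalars k).map toLayeredTensorAlgebra.A.val.toLinearMap *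
      toLayeredTensorAlgebra.V ⊔
    toLayeredTensorAlgebra.V ^ 2 *
      (I.restrictScalars k).map toLayeredTensorAlgebra.A.val.toLinearMap
  δδ_V : ∀ v ∈ toLayeredTensorAlgebra.V, δ (δ v) ∈
    (I.restrictScalars k).map toLayeredTensorAlgebra.A.val.toLinearMap *
      toLayeredTensorAlgebra.V ^ 3 ⊔
    toLayeredTensorAlgebra.V *
      (I.restrictScalars k).map toLayeredTensorAlgebra.A.val.toLinearMap *
      toLayeredTensorAlgebra.V ^ 2 ⊔
    toLayeredTensorAlgebra.V ^ 2 *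
      (I.restrictScalars k).map toLayeredTensorAlgebra.A.val.toLinearMap *
      toLayeredTensorAlgebra.V ⊔
    toLayeredTensorAlgebra.V ^ 3 *
      (I.restrictScalars k).map toLayeredTensorAlgebra.A.val.toLinearMap

namespace InterlacedWeakDitalgebra

variable {k T : Type u} [Field k] [Ring T] [Algebra k T] (𝒜 : InterlacedWeakDitalgebra k T)

instance : 𝒜.I.IsTwoSided := 𝒜.twoSided

theorem δ_A_mem {a : T} (ha : a ∈ 𝒜.A) : 𝒜.δ a ∈ 𝒜.V := by
  have := 𝒜.δ_mem 0 a ha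
  simpa [LayeredTensorAlgebra.grade] using this

theorem δ_V_mem {v : T} (hv : v ∈ 𝒜.V) : 𝒜.δ v ∈ 𝒜.V * 𝒜.V := by
  have := 𝒜.δ_mem 1 v (by simpa [LayeredTensorAlgebra.grade] using hv)
  simpa [LayeredTensorAlgebra.grade, pow_two] using this

theorem δ_mul_A {a : T} (ha : a ∈ 𝒜.A) (t : T) : 𝒜.δ (a * t) = 𝒜.δ a * t + a * 𝒜.δ t := by
  have := 𝒜.leibniz 0 a t ha
  simpa using this

theorem δ_mul_V {v : T} (hv : v ∈ 𝒜.V) (t : T) : 𝒜.δ (v * t) = 𝒜.δ v * t - v * 𝒜.δ t := by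
  have := 𝒜.leibniz 1 v t (by simpa [LayeredTensorAlgebra.grade] using hv)
  simpa [sub_eq_add_neg] using this

/-- The restriction `A → V` of `δ`. -/
def δA (a : 𝒜.A) : 𝒜.V := ⟨𝒜.δ a, 𝒜.δ_A_mem a.2⟩

/-- An algebra morphism on `T` which kills `I` kills `δ²(A)` and `δ²(V)`. -/
theorem map_δδ {B : Type u} [Ring B] [Algebra k B] (Φ : T →ₐ[k] B)
    (hΦ : ∀ a ∈ 𝒜.I, Φ a = 0) {t : T} (ht : t ∈ 𝒜.A ∨ t ∈ 𝒜.V) : Φ (𝒜.δ (𝒜.δ t)) = 0 := by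
  have hJ : (𝒜.I.restrictScalars k).map 𝒜.A.val.toLinearMap ≤ LinearMap.ker Φ.toLinearMap := by
    rintro _ ⟨a, ha, rfl⟩
    exact hΦ a ha
  have hl : ∀ P Q : Submodule k T, P ≤ LinearMap.ker Φ.toLinearMap →
      P * Q ≤ LinearMap.ker Φ.toLinearMap := fun P Q h =>
    Submodule.mul_le.2 fun p hp q _ => by
      have : Φ p = 0 := h hp
      simp [this]
  have hr : ∀ P Q : Submodule k T, Q ≤ LinearMap.ker Φ.toLinearMap →
      P * Q ≤ LinearMap.ker Φ.toLinearMap := fun P Q h =>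
    Submodule.mul_le.2 fun p _ q hq => by
      have : Φ q = 0 := h hq
      simp [this]
  rcases ht with ht | ht
  · exact sup_le (sup_le (hl _ _ hJ) (hl _ _ (hr _ _ hJ))) (hr _ _ hJ) (𝒜.δδ_A t ht)
  · exact sup_le (sup_le (sup_le (hl _ _ hJ) (hl _ _ (hr _ _ hJ))) (hl _ _ (hr _ _ hJ)))
      (hr _ _ hJ) (𝒜.δδ_V t ht)

/-! ## The category of modules -/

/-- An object of `(𝒜, I)`-Mod: an `A`-module (a `k`-vector space with an algebra morphism
`A → End_k(M)`) annihilated by `I`. -/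
structure Mod where
  /-- the underlying vector space -/
  carrier : Type u
  [addCommGroup : AddCommGroup carrier]
  [module : Module k carrier]
  /-- the action of `A` -/
  act : 𝒜.A →ₐ[k] Module.End k carrier
  act_I : ∀ a ∈ 𝒜.I, act a = 0

namespace Mod

variable {𝒜}

instance : CoeSort 𝒜.Mod (Type u) := ⟨Mod.carrier⟩
instance (M : 𝒜.Mod) : AddCommGroup M := M.addCommGroup
instance (M : 𝒜.Mod) : Module k M := M.module

/-- A morphism of `A`-`A`-bimodules `V → Hom_k(M, N)`. -/
@[ext]
structure BimodHom (M N : 𝒜.Mod) where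
  /-- the underlying linear map -/
  toMap : 𝒜.V →ₗ[k] (M →ₗ[k] N)
  map_lmul : ∀ (a : 𝒜.A) (v : 𝒜.V), toMap (𝒜.lmul a v) = N.act a ∘ₗ toMap v
  map_rmul : ∀ (a : 𝒜.A) (v : 𝒜.V), toMap (𝒜.rmul v a) = toMap v ∘ₗ M.act a

/-- A morphism `(f⁰, f¹) : M → N`. The map `f⁰` is automatically `R`-linear, as `δ(R) = 0`. -/
@[ext]
structure Hom (M N : 𝒜.Mod) where
  /-- the component `f⁰` -/
  f0 : M →ₗ[k] N
  /-- the component `f¹` -/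
  f1 : BimodHom M N
  comm : ∀ (a : 𝒜.A) (m : M), N.act a (f0 m) = f0 (M.act a m) + f1.toMap (𝒜.δA a) m

/-- The diagonal action on a direct sum. -/
def prodAct {C X Y : Type u} [Ring C] [Algebra k C] [AddCommGroup X] [Module k X]
    [AddCommGroup Y] [Module k Y] (ρ : C →ₐ[k] Module.End k X) (σ : C →ₐ[k] Module.End k Y) :
    C →ₐ[k] Module.End k (X × Y) where
  toFun a := (ρ a).prodMap (σ a)
  map_one' := by
    rw [map_one, map_one]
    rfl
  map_mul' a b := by
    rw [map_mul, map_mul]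
    rfl
  map_zero' := by
    rw [map_zero, map_zero]
    rfl
  map_add' a b := by
    rw [map_add, map_add]
    rfl
  commutes' c := by
    rw [AlgHom.commutes, AlgHom.commutes]
    rfl

section Conv

variable {L M N P : 𝒜.Mod}

theorem exists_conv₂ (g : BimodHom M N) (f : BimodHom L M) :
    ∃ c : T →ₗ[k] (L →ₗ[k] N),
      (∀ v w : 𝒜.V, c (v * w) = g.toMap v ∘ₗ f.toMap w) ∧
      (∀ (a : 𝒜.A) (t : T), c (a * t) = N.act a ∘ₗ c t) ∧
      (∀ (a : 𝒜.A) (t : T), c (t * a) = c t ∘ₗ L.act a) ∧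
      (∀ a ∈ 𝒜.A, c (𝒜.δ (𝒜.δ a)) = 0) := by
  let φ : 𝒜.A →ₐ[k] Module.End k (L × M × N) := prodAct L.act (prodAct M.act N.act)
  let ψ : 𝒜.V →ₗ[k] Module.End k (L × M × N) :=
    { toFun := fun v => LinearMap.prod 0 (LinearMap.prod
        (f.toMap v ∘ₗ LinearMap.fst k L (M × N))
        (g.toMap v ∘ₗ LinearMap.fst k M N ∘ₗ LinearMap.snd k L (M × N)))
      map_add' := fun a b => by
        apply LinearMap.ext
        intro x
        simp
      map_smul' := fun a b => by
        apply LinearMap.ext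
        intro x
        simp }
  have hφ : ∀ (a : 𝒜.A) (l : L) (m : M) (n : N), φ a (l, m, n) = (L.act a l, M.act a m, N.act a n) :=
    fun _ _ _ _ => rfl
  have hψ : ∀ (v : 𝒜.V) (l : L) (m : M) (n : N), ψ v (l, m, n) = (0, f.toMap v l, g.toMap v m) :=
    fun _ _ _ _ => rfl
  obtain ⟨Φ, hA, hV⟩ := 𝒜.exists_lift φ ψ
    (fun a v => by
      apply LinearMap.ext; rintro ⟨l, m, n⟩
      simp only [Module.End.mul_apply, hφ, hψ, f.map_lmul, g.map_lmul, LinearMap.comp_apply,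
        map_zero])
    (fun a v => by
      apply LinearMap.ext; rintro ⟨l, m, n⟩
      simp only [Module.End.mul_apply, hφ, hψ, f.map_rmul, g.map_rmul, LinearMap.comp_apply])
  have hI : ∀ a ∈ 𝒜.I, Φ a = 0 := fun a ha => by
    rw [hA]
    apply LinearMap.ext; rintro ⟨l, m, n⟩
    simp [hφ, L.act_I a ha, M.act_I a ha, N.act_I a ha]
  let c : T →ₗ[k] (L →ₗ[k] N) :=
    { toFun := fun t => LinearMap.snd k M N ∘ₗ LinearMap.snd k L (M × N) ∘ₗ Φ t ∘ₗ
        LinearMap.inl k L (M × N)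
      map_add' := fun s t => by ext; simp
      map_smul' := fun s t => by ext; simp }
  have hc : ∀ t l, c t l = (Φ t (l, 0, 0)).2.2 := fun _ _ => rfl
  refine ⟨c, fun v w => ?_, fun a t => ?_, fun a t => ?_, fun a ha => ?_⟩
  · ext l
    rw [hc, map_mul, hV, hV, Module.End.mul_apply, hψ, hψ]
    rfl
  · ext l
    rw [hc, map_mul, hA, Module.End.mul_apply, LinearMap.comp_apply, hc]
    rfl
  · ext l
    rw [hc, map_mul, hA, Module.End.mul_apply, LinearMap.comp_apply, hc, hφ, map_zero, map_zero]
  · ext l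
    rw [hc, 𝒜.map_δδ Φ hI (Or.inl ha)]
    rfl

/-- The map `T → Hom_k(L, N)` which sends the product `v w` of two elements of `V` to
`g¹(v) f¹(w)`. -/
noncomputable def conv (g : BimodHom M N) (f : BimodHom L M) : T →ₗ[k] (L →ₗ[k] N) :=
  (exists_conv₂ g f).choose

theorem conv_mul (g : BimodHom M N) (f : BimodHom L M) (v w : 𝒜.V) :
    conv g f (v * w) = g.toMap v ∘ₗ f.toMap w := (exists_conv₂ g f).choose_spec.1 v w

theorem conv_lmul (g : BimodHom M N) (f : BimodHom L M) (a : 𝒜.A) (t : T) :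
    conv g f (a * t) = N.act a ∘ₗ conv g f t := (exists_conv₂ g f).choose_spec.2.1 a t

theorem conv_rmul (g : BimodHom M N) (f : BimodHom L M) (a : 𝒜.A) (t : T) :
    conv g f (t * a) = conv g f t ∘ₗ L.act a := (exists_conv₂ g f).choose_spec.2.2.1 a t

theorem conv_δδ (g : BimodHom M N) (f : BimodHom L M) {a : T} (ha : a ∈ 𝒜.A) :
    conv g f (𝒜.δ (𝒜.δ a)) = 0 := (exists_conv₂ g f).choose_spec.2.2.2 a ha

theorem exists_conv₃ (h : BimodHom N P) (g : BimodHom M N) (f : BimodHom L M) :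
    ∃ c : T →ₗ[k] (L →ₗ[k] P),
      (∀ u v w : 𝒜.V, c (u * v * w) = h.toMap u ∘ₗ g.toMap v ∘ₗ f.toMap w) ∧
      (∀ v ∈ 𝒜.V, c (𝒜.δ (𝒜.δ v)) = 0) := by
  let φ : 𝒜.A →ₐ[k] Module.End k (L × M × N × P) :=
    prodAct L.act (prodAct M.act (prodAct N.act P.act))
  let ψ : 𝒜.V →ₗ[k] Module.End k (L × M × N × P) :=
    { toFun := fun v => LinearMap.prod 0 (LinearMap.prod
        (f.toMap v ∘ₗ LinearMap.fst k L (M × N × P)) (LinearMap.prod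
        (g.toMap v ∘ₗ LinearMap.fst k M (N × P) ∘ₗ LinearMap.snd k L (M × N × P))
        (h.toMap v ∘ₗ LinearMap.fst k N P ∘ₗ LinearMap.snd k M (N × P) ∘ₗ
          LinearMap.snd k L (M × N × P))))
      map_add' := fun a b => by
        apply LinearMap.ext
        intro x
        simp
      map_smul' := fun a b => by
        apply LinearMap.ext
        intro x
        simp }
  have hφ : ∀ (a : 𝒜.A) (l : L) (m : M) (n : N) (p : P),
      φ a (l, m, n, p) = (L.act a l, M.act a m, N.act a n, P.act a p) :=
    fun _ _ _ _ _ => rfl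
  have hψ : ∀ (v : 𝒜.V) (l : L) (m : M) (n : N) (p : P),
      ψ v (l, m, n, p) = (0, f.toMap v l, g.toMap v m, h.toMap v n) :=
    fun _ _ _ _ _ => rfl
  obtain ⟨Φ, hA, hV⟩ := 𝒜.exists_lift φ ψ
    (fun a v => by
      apply LinearMap.ext; rintro ⟨l, m, n, p⟩
      simp only [Module.End.mul_apply, hφ, hψ, f.map_lmul, g.map_lmul, h.map_lmul,
        LinearMap.comp_apply, map_zero])
    (fun a v => by
      apply LinearMap.ext; rintro ⟨l, m, n, p⟩
      simp only [Module.End.mul_apply, hφ, hψ, f.map_rmul, g.map_rmul, h.map_rmul,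
        LinearMap.comp_apply])
  have hI : ∀ a ∈ 𝒜.I, Φ a = 0 := fun a ha => by
    rw [hA]
    apply LinearMap.ext; rintro ⟨l, m, n, p⟩
    simp [hφ, L.act_I a ha, M.act_I a ha, N.act_I a ha, P.act_I a ha]
  let c : T →ₗ[k] (L →ₗ[k] P) :=
    { toFun := fun t => LinearMap.snd k N P ∘ₗ LinearMap.snd k M (N × P) ∘ₗ
        LinearMap.snd k L (M × N × P) ∘ₗ Φ t ∘ₗ LinearMap.inl k L (M × N × P)
      map_add' := fun s t => by ext; simp
      map_smul' := fun s t => by ext; simp }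
  have hc : ∀ t l, c t l = (Φ t (l, 0, 0, 0)).2.2.2 := fun _ _ => rfl
  refine ⟨c, fun u v w => ?_, fun v hv => ?_⟩
  · ext l
    rw [hc, map_mul, map_mul, hV, hV, hV, Module.End.mul_apply, Module.End.mul_apply, hψ, hψ, hψ]
    rfl
  · ext l
    rw [hc, 𝒜.map_δδ Φ hI (Or.inr hv)]
    rfl

end Conv

variable {L M N P : 𝒜.Mod}

/-- The identity `(id, 0)`. -/
def Hom.id (M : 𝒜.Mod) : Hom M M where
  f0 := LinearMap.id
  f1 := ⟨0, by simp, by simp⟩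
  comm := by simp

/-- The composition, with `(g f)⁰ = g⁰ f⁰` and, for `v ∈ V` with `δ(v) = ∑ uᵢ wᵢ`,
`(g f)¹(v) = g⁰ f¹(v) + g¹(v) f⁰ + ∑ g¹(uᵢ) f¹(wᵢ)`. -/
noncomputable def Hom.comp (f : Hom L M) (g : Hom M N) : Hom L N where
  f0 := g.f0 ∘ₗ f.f0
  f1 :=
    { toMap :=
        { toFun := fun v => g.f0 ∘ₗ f.f1.toMap v + g.f1.toMap v ∘ₗ f.f0 +
            conv g.f1 f.f1 (𝒜.δ v)
          map_add' := fun v w => by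
            ext l
            simp only [map_add, LinearMap.add_apply, LinearMap.comp_apply, Submodule.coe_add]
            abel
          map_smul' := fun c v => by
            ext l
            simp only [map_smul, LinearMap.add_apply, LinearMap.comp_apply, Submodule.coe_smul,
              LinearMap.smul_apply, RingHom.id_apply, smul_add] }
      map_lmul := fun a v => by
        ext l
        have e : conv g.f1 f.f1 (𝒜.δ (𝒜.lmul a v : 𝒜.V)) =
            g.f1.toMap (𝒜.δA a) ∘ₗ f.f1.toMap v + N.act a ∘ₗ conv g.f1 f.f1 (𝒜.δ v) := by
          rw [← conv_lmul, ← conv_mul, ← map_add]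
          exact congrArg _ (𝒜.δ_mul_A a.2 v)
        simp only [LinearMap.coe_mk, AddHom.coe_mk, e, f.f1.map_lmul, g.f1.map_lmul,
          LinearMap.add_apply, LinearMap.comp_apply, map_add, g.comm]
        abel
      map_rmul := fun a v => by
        ext l
        have e : conv g.f1 f.f1 (𝒜.δ (𝒜.rmul v a : 𝒜.V)) =
            conv g.f1 f.f1 (𝒜.δ v) ∘ₗ L.act a - g.f1.toMap v ∘ₗ f.f1.toMap (𝒜.δA a) := by
          rw [← conv_rmul, ← conv_mul, ← map_sub]
          exact congrArg _ (𝒜.δ_mul_V v.2 a)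
        simp only [LinearMap.coe_mk, AddHom.coe_mk, e, f.f1.map_rmul, g.f1.map_rmul,
          LinearMap.add_apply, LinearMap.comp_apply, LinearMap.sub_apply, map_add, f.comm]
        abel }
  comm := fun a m => by
    have e : conv g.f1 f.f1 (𝒜.δ (𝒜.δA a : 𝒜.V)) = 0 := conv_δδ _ _ a.2
    simp only [LinearMap.coe_mk, AddHom.coe_mk, e, LinearMap.add_apply, LinearMap.comp_apply,
      LinearMap.zero_apply, g.comm, f.comm, map_add]
    abel

theorem Hom.comp_f1_apply (f : Hom L M) (g : Hom M N) (v : 𝒜.V) (l : L) :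
    (f.comp g).f1.toMap v l = g.f0 (f.f1.toMap v l) + g.f1.toMap v (f.f0 l) +
      conv g.f1 f.f1 (𝒜.δ v) l := rfl

theorem conv_eq_zero (g : BimodHom M N) (f : BimodHom L M)
    (h : (∀ v, g.toMap v = 0) ∨ ∀ v, f.toMap v = 0) {t : T} (ht : t ∈ 𝒜.V * 𝒜.V) :
    conv g f t = 0 := by
  induction ht using Submodule.mul_induction_on' with
  | mem_mul_mem v hv w hw =>
    rw [conv_mul g f ⟨v, hv⟩ ⟨w, hw⟩]
    rcases h with h | h <;> rw [h] <;> simp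
  | add x _ y _ hx hy => rw [map_add, hx, hy, add_zero]

theorem conv_add_left (g g' h : BimodHom M N) (f : BimodHom L M)
    (e : ∀ v, h.toMap v = g.toMap v + g'.toMap v) {t : T} (ht : t ∈ 𝒜.V * 𝒜.V) :
    conv h f t = conv g f t + conv g' f t := by
  induction ht using Submodule.mul_induction_on' with
  | mem_mul_mem v hv w hw =>
    rw [conv_mul _ f ⟨v, hv⟩ ⟨w, hw⟩, conv_mul _ f ⟨v, hv⟩ ⟨w, hw⟩, conv_mul _ f ⟨v, hv⟩ ⟨w, hw⟩, e,
      LinearMap.add_comp]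
  | add x _ y _ hx hy => rw [map_add, map_add, map_add, hx, hy]; abel

theorem conv_add_right (g : BimodHom M N) (f f' h : BimodHom L M)
    (e : ∀ v, h.toMap v = f.toMap v + f'.toMap v) {t : T} (ht : t ∈ 𝒜.V * 𝒜.V) :
    conv g h t = conv g f t + conv g f' t := by
  induction ht using Submodule.mul_induction_on' with
  | mem_mul_mem v hv w hw =>
    rw [conv_mul g _ ⟨v, hv⟩ ⟨w, hw⟩, conv_mul g _ ⟨v, hv⟩ ⟨w, hw⟩, conv_mul g _ ⟨v, hv⟩ ⟨w, hw⟩, e,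
      LinearMap.comp_add]
  | add x _ y _ hx hy => rw [map_add, map_add, map_add, hx, hy]; abel

theorem Hom.assoc (f : Hom L M) (g : Hom M N) (h : Hom N P) :
    (f.comp g).comp h = f.comp (g.comp h) := by
  obtain ⟨c, hc, hδ⟩ := exists_conv₃ h.f1 g.f1 f.f1
  have c_left : ∀ s ∈ 𝒜.V * 𝒜.V, ∀ w : 𝒜.V, c (s * w) = conv h.f1 g.f1 s ∘ₗ f.f1.toMap w := by
    intro s hs w
    induction hs using Submodule.mul_induction_on' with
    | mem_mul_mem u hu v hv =>
      rw [conv_mul _ _ ⟨u, hu⟩ ⟨v, hv⟩]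
      exact hc ⟨u, hu⟩ ⟨v, hv⟩ w
    | add x _ y _ hx hy => rw [add_mul, map_add, hx, hy, map_add, LinearMap.add_comp]
  have c_right : ∀ s ∈ 𝒜.V * 𝒜.V, ∀ u : 𝒜.V, c (u * s) = h.f1.toMap u ∘ₗ conv g.f1 f.f1 s := by
    intro s hs u
    induction hs using Submodule.mul_induction_on' with
    | mem_mul_mem v hv w hw =>
      rw [conv_mul _ _ ⟨v, hv⟩ ⟨w, hw⟩, ← mul_assoc]
      exact hc u ⟨v, hv⟩ ⟨w, hw⟩
    | add x _ y _ hx hy => rw [mul_add, map_add, hx, hy, map_add, LinearMap.comp_add]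
  have key : ∀ t ∈ 𝒜.V * 𝒜.V,
      conv (g.comp h).f1 f.f1 t + h.f0 ∘ₗ (0 : L →ₗ[k] N) =
        h.f0 ∘ₗ conv g.f1 f.f1 t + conv h.f1 (f.comp g).f1 t -
          conv h.f1 g.f1 t ∘ₗ f.f0 + c (𝒜.δ t) := by
    intro t ht
    induction ht using Submodule.mul_induction_on' with
    | mem_mul_mem v hv w hw =>
      have e : c (𝒜.δ (v * w)) = conv h.f1 g.f1 (𝒜.δ v) ∘ₗ f.f1.toMap ⟨w, hw⟩ -
          h.f1.toMap ⟨v, hv⟩ ∘ₗ conv g.f1 f.f1 (𝒜.δ w) := by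
        rw [← c_left _ (𝒜.δ_V_mem hv) ⟨w, hw⟩, ← c_right _ (𝒜.δ_V_mem hw) ⟨v, hv⟩, ← map_sub]
        exact congrArg _ (𝒜.δ_mul_V hv w)
      rw [e, conv_mul _ _ ⟨v, hv⟩ ⟨w, hw⟩, conv_mul _ _ ⟨v, hv⟩ ⟨w, hw⟩,
        conv_mul _ _ ⟨v, hv⟩ ⟨w, hw⟩, conv_mul _ _ ⟨v, hv⟩ ⟨w, hw⟩]
      ext l
      simp only [LinearMap.add_apply, LinearMap.sub_apply, LinearMap.comp_apply,
        Hom.comp_f1_apply, map_add, LinearMap.zero_apply, map_zero]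
      abel
    | add x _ y _ hx hy =>
      have := congrArg₂ (· + ·) hx hy
      ext l
      have := LinearMap.congr_fun this l
      simp only [LinearMap.add_apply, LinearMap.sub_apply, LinearMap.comp_apply, map_add,
        LinearMap.zero_apply, map_zero, add_zero] at this ⊢
      rw [this]
      abel
  apply Hom.ext
  · rfl
  apply BimodHom.ext
  apply LinearMap.ext
  intro v
  apply LinearMap.ext
  intro l
  have := LinearMap.congr_fun (key _ (𝒜.δ_V_mem v.2)) l
  rw [hδ v v.2] at this
  simp only [LinearMap.add_apply, LinearMap.sub_apply, LinearMap.comp_apply,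
    LinearMap.zero_apply, map_zero, add_zero] at this
  rw [Hom.comp_f1_apply, Hom.comp_f1_apply, Hom.comp_f1_apply, Hom.comp_f1_apply, this]
  simp only [Hom.comp, LinearMap.comp_apply, map_add]
  abel

noncomputable instance : Category 𝒜.Mod where
  Hom := Hom
  id := Hom.id
  comp := Hom.comp
  id_comp f := by
    apply Hom.ext
    · rfl
    apply BimodHom.ext
    ext v l
    rw [Hom.comp_f1_apply, conv_eq_zero _ _ (Or.inr fun _ => rfl) (𝒜.δ_V_mem v.2)]
    simp [Hom.id]
  comp_id f := by
    apply Hom.ext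
    · rfl
    apply BimodHom.ext
    ext v l
    rw [Hom.comp_f1_apply, conv_eq_zero _ _ (Or.inl fun _ => rfl) (𝒜.δ_V_mem v.2)]
    simp [Hom.id]
  assoc := Hom.assoc

/-! ### The additive structure, direct sums -/

instance : Zero (M ⟶ N) := ⟨⟨0, ⟨0, by simp, by simp⟩, by simp⟩⟩

instance : Add (M ⟶ N) := ⟨fun f g =>
  { f0 := Hom.f0 f + Hom.f0 g
    f1 :=
      { toMap := (Hom.f1 f).toMap + (Hom.f1 g).toMap
        map_lmul := fun a v => by
          simp [(Hom.f1 f).map_lmul, (Hom.f1 g).map_lmul, LinearMap.comp_add]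
        map_rmul := fun a v => by
          simp [(Hom.f1 f).map_rmul, (Hom.f1 g).map_rmul, LinearMap.add_comp] }
    comm := fun a m => by
      simp only [LinearMap.add_apply, map_add, Hom.comm f, Hom.comm g]
      abel }⟩

instance : Neg (M ⟶ N) := ⟨fun f =>
  { f0 := - Hom.f0 f
    f1 :=
      { toMap := - (Hom.f1 f).toMap
        map_lmul := fun a v => by
          simp [(Hom.f1 f).map_lmul, LinearMap.comp_neg]
        map_rmul := fun a v => by
          simp [(Hom.f1 f).map_rmul, LinearMap.neg_comp] }
    comm := fun a m => by
      simp only [LinearMap.neg_apply, map_neg, Hom.comm f]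
      abel }⟩

@[ext]
theorem hom_ext {f g : M ⟶ N} (h0 : ∀ m, Hom.f0 f m = Hom.f0 g m)
    (h1 : ∀ v m, (Hom.f1 f).toMap v m = (Hom.f1 g).toMap v m) : f = g :=
  Hom.ext (LinearMap.ext h0)
    (BimodHom.ext (LinearMap.ext fun v => LinearMap.ext (h1 v)))

theorem zero_f0 (m : M) : Hom.f0 (0 : M ⟶ N) m = 0 := rfl
theorem zero_f1 (v : 𝒜.V) (m : M) : (Hom.f1 (0 : M ⟶ N)).toMap v m = 0 := rfl
theorem add_f0 (f g : M ⟶ N) (m : M) : Hom.f0 (f + g) m = Hom.f0 f m + Hom.f0 g m := rfl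
theorem add_f1 (f g : M ⟶ N) (v : 𝒜.V) (m : M) :
    (Hom.f1 (f + g)).toMap v m = (Hom.f1 f).toMap v m + (Hom.f1 g).toMap v m := rfl
theorem neg_f0 (f : M ⟶ N) (m : M) : Hom.f0 (-f) m = - Hom.f0 f m := rfl
theorem neg_f1 (f : M ⟶ N) (v : 𝒜.V) (m : M) :
    (Hom.f1 (-f)).toMap v m = - (Hom.f1 f).toMap v m := rfl
theorem id_f0 (m : M) : Hom.f0 (𝟙 M) m = m := rfl
theorem id_f1 (v : 𝒜.V) (m : M) : (Hom.f1 (𝟙 M)).toMap v m = 0 := rfl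
theorem comp_f0 (f : L ⟶ M) (g : M ⟶ N) (l : L) : Hom.f0 (f ≫ g) l = Hom.f0 g (Hom.f0 f l) := rfl
theorem comp_f1 (f : L ⟶ M) (g : M ⟶ N) (v : 𝒜.V) (l : L) :
    (Hom.f1 (f ≫ g)).toMap v l = Hom.f0 g ((Hom.f1 f).toMap v l) +
      (Hom.f1 g).toMap v (Hom.f0 f l) + conv (Hom.f1 g) (Hom.f1 f) (𝒜.δ v) l := rfl

instance : AddCommGroup (M ⟶ N) where
  add_assoc f g h := by ext <;> simp only [add_f0, add_f1, add_assoc]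
  zero_add f := by ext <;> simp only [add_f0, add_f1, zero_f0, zero_f1, zero_add]
  add_zero f := by ext <;> simp only [add_f0, add_f1, zero_f0, zero_f1, add_zero]
  nsmul := nsmulRec
  zsmul := zsmulRec
  neg_add_cancel f := by
    ext <;> simp only [add_f0, add_f1, neg_f0, neg_f1, zero_f0, zero_f1, neg_add_cancel]
  add_comm f g := by ext <;> simp only [add_f0, add_f1, add_comm]

noncomputable instance : Preadditive 𝒜.Mod where
  add_comp L M N f f' g := by
    ext
    · simp only [comp_f0, add_f0, map_add]
    · rename_i v l
      have := conv_add_right (Hom.f1 g) (Hom.f1 f) (Hom.f1 f') (Hom.f1 (f + f'))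
        (fun _ => rfl) (𝒜.δ_V_mem v.2)
      simp only [comp_f1, add_f0, add_f1, map_add, this, LinearMap.add_apply]
      abel
  comp_add L M N f g g' := by
    ext
    · simp only [comp_f0, add_f0]
    · rename_i v l
      have := conv_add_left (Hom.f1 g) (Hom.f1 g') (Hom.f1 (g + g')) (Hom.f1 f)
        (fun _ => rfl) (𝒜.δ_V_mem v.2)
      simp only [comp_f1, add_f0, add_f1, this, LinearMap.add_apply]
      abel

/-- An `A`-linear map `f⁰` gives the morphism `(f⁰, 0)`. -/
def ofLinear (f : M →ₗ[k] N) (hf : ∀ a m, f (M.act a m) = N.act a (f m)) : M ⟶ N :=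
  Hom.mk f ⟨0, by simp, by simp⟩ fun a m => by simp [hf]

/-- The direct sum of two modules. -/
def prod (M N : 𝒜.Mod) : 𝒜.Mod where
  carrier := M × N
  act := prodAct M.act N.act
  act_I a ha := by
    change (M.act a).prodMap (N.act a) = 0
    rw [M.act_I a ha, N.act_I a ha]
    rfl

theorem ofLinear_comp (f : L →ₗ[k] M) (hf) (g : M →ₗ[k] N) (hg) :
    ofLinear f hf ≫ ofLinear g hg = ofLinear (g ∘ₗ f) (by simp [hf, hg]) := by
  ext
  · rfl
  · rename_i v l
    rw [comp_f1, conv_eq_zero _ _ (Or.inl fun _ => rfl) (𝒜.δ_V_mem v.2)]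
    simp [ofLinear]

/-- The first projection. -/
def prodFst (M N : 𝒜.Mod) : prod M N ⟶ M :=
  ofLinear (M := prod M N) (LinearMap.fst k M N : M × N →ₗ[k] M) fun _ _ => rfl

/-- The second projection. -/
def prodSnd (M N : 𝒜.Mod) : prod M N ⟶ N :=
  ofLinear (M := prod M N) (LinearMap.snd k M N : M × N →ₗ[k] N) fun _ _ => rfl

/-- The first inclusion. -/
def prodInl (M N : 𝒜.Mod) : M ⟶ prod M N :=
  ofLinear (N := prod M N) (LinearMap.inl k M N : M →ₗ[k] M × N) fun a m => by
    change (M.act a m, (0 : N)) = (M.act a m, N.act a 0)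
    rw [map_zero]

/-- The second inclusion. -/
def prodInr (M N : 𝒜.Mod) : N ⟶ prod M N :=
  ofLinear (N := prod M N) (LinearMap.inr k M N : N →ₗ[k] M × N) fun a m => by
    change ((0 : M), N.act a m) = (M.act a 0, N.act a m)
    rw [map_zero]

theorem prod_total (M N : 𝒜.Mod) :
    prodFst M N ≫ prodInl M N + prodSnd M N ≫ prodInr M N = 𝟙 (prod M N) := by
  apply hom_ext
  · intro m
    exact Prod.fst_add_snd (M := M) (N := N) m
  · intro v m
    rw [add_f1, comp_f1, comp_f1, conv_eq_zero _ _ (Or.inl fun _ => rfl) (𝒜.δ_V_mem v.2),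
      conv_eq_zero _ _ (Or.inl fun _ => rfl) (𝒜.δ_V_mem v.2)]
    change ((0 : M × N) + 0 + 0) + (0 + 0 + 0) = 0
    simp

instance : HasBinaryBiproducts 𝒜.Mod where
  has_binary_biproduct M N := hasBinaryBiproduct_of_total
    { pt := prod M N
      fst := prodFst M N
      snd := prodSnd M N
      inl := prodInl M N
      inr := prodInr M N
      inl_fst := (ofLinear_comp _ _ _ _).trans rfl
      inl_snd := (ofLinear_comp _ _ _ _).trans rfl
      inr_fst := (ofLinear_comp _ _ _ _).trans rfl
      inr_snd := (ofLinear_comp _ _ _ _).trans rfl } (prod_total M N)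

/-! ### Endolength -/

/-- `End(M)` acts on `M` by `(f⁰, f¹) • m = f⁰(m)`. (The multiplication of `End M` is
`g * f = f ≫ g`, so a left `End M`-module is the same as a right module over its opposite.) -/
instance endModule (M : 𝒜.Mod) : Module (End M) M where
  smul f m := Hom.f0 f m
  one_smul _ := rfl
  mul_smul _ _ _ := rfl
  smul_zero f := map_zero (Hom.f0 f)
  smul_add f := map_add (Hom.f0 f)
  add_smul _ _ _ := rfl
  zero_smul _ := rfl

/-- The endolength of `M`. -/
noncomputable def endolength (M : 𝒜.Mod) : ℕ∞ := Module.length (End M) M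

/-- `M` is pregeneric: indecomposable, of finite endolength and of infinite dimension. -/
def IsPregeneric (M : 𝒜.Mod) : Prop :=
  Indecomposable M ∧ M.endolength ≠ ⊤ ∧ ¬ FiniteDimensional k M

end Mod

/-- For each `d ∈ ℕ` there are only finitely many isomorphism classes of pregeneric modules of
endolength `d`. -/
def PregenericallyTame : Prop :=
  ∀ d : ℕ, ∃ S : Set 𝒜.Mod, S.Finite ∧
    ∀ M : 𝒜.Mod, M.IsPregeneric → M.endolength = d → ∃ N ∈ S, Nonempty (M ≅ N)

/-! ## The canonical embedding of `A/I`-Mod -/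

/-- The quotient algebra `A/I`. -/
abbrev QuotAlg : Type u := 𝒜.A ⧸ 𝒜.I

/-- An `A/I`-module is a `k`-vector space. -/
abbrev quotModule (M : Type u) [AddCommGroup M] [Module 𝒜.QuotAlg M] : Module k M :=
  Module.compHom M (algebraMap k 𝒜.QuotAlg)

/-- An `A/I`-module is an object of `(𝒜, I)`-Mod. -/
def ofQuot (M : Type u) [AddCommGroup M] [Module 𝒜.QuotAlg M] : 𝒜.Mod :=
  letI : Module k M := 𝒜.quotModule M
  haveI : IsScalarTower k 𝒜.QuotAlg M := ⟨fun c q m => by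
    rw [Algebra.smul_def, mul_smul]
    rfl⟩
  { carrier := M
    act := (Algebra.lsmul k k M).comp (Ideal.Quotient.mkₐ k 𝒜.I)
    act_I := fun a ha => by
      have h : Ideal.Quotient.mkₐ k 𝒜.I a = 0 := Ideal.Quotient.eq_zero_iff_mem.2 ha
      rw [AlgHom.comp_apply, h, map_zero] }

/-- An `A/I`-linear map `f⁰` is mapped to `(f⁰, 0)`. -/
def ofQuotMap {M N : Type u} [AddCommGroup M] [Module 𝒜.QuotAlg M] [AddCommGroup N]
    [Module 𝒜.QuotAlg N] (f : M →ₗ[𝒜.QuotAlg] N) : 𝒜.ofQuot M ⟶ 𝒜.ofQuot N :=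
  letI : Module k M := 𝒜.quotModule M
  letI : Module k N := 𝒜.quotModule N
  Mod.ofLinear (M := 𝒜.ofQuot M) (N := 𝒜.ofQuot N)
    ({ toFun := f
       map_add' := map_add f
       map_smul' := fun c m => map_smul f (algebraMap k 𝒜.QuotAlg c) m } : M →ₗ[k] N)
    fun a (m : M) => map_smul f (Ideal.Quotient.mk 𝒜.I a) m

/-- The functor `A/I-Mod ⥤ (𝒜, I)-Mod` which is the identity on objects and maps `f⁰` to
`(f⁰, 0)`. -/
noncomputable def canonicalEmbedding : ModuleCat.{u} 𝒜.QuotAlg ⥤ 𝒜.Mod where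
  obj M := 𝒜.ofQuot M
  map f := 𝒜.ofQuotMap f.hom
  map_id _ := rfl
  map_comp f g := by
    apply Mod.hom_ext
    · intro m
      rfl
    · intro v m
      rw [Mod.comp_f1, Mod.conv_eq_zero _ _ (Or.inl fun _ => rfl) (𝒜.δ_V_mem v.2)]
      exact ((add_zero _).trans ((add_zero _).trans (map_zero _))).symm

end InterlacedWeakDitalgebra

/-! ## Tensor products over noncommutative rings, wildness -/

section BalancedTensor

variable (Q F : Type u) [Ring Q] [Ring F] (Z : Type u) [AddCommGroup Z] [Module Q Z]
  [Module Fᵐᵒᵖ Z]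

/-- For a `Q`-`F`-bimodule `Z` and a left `F`-module `N`, the `Q`-submodule of `Z ⊗_ℤ N` generated
by the elements `z f ⊗ n - z ⊗ f n`. -/
def balancedRelations (N : Type u) [AddCommGroup N] [Module F N] : Submodule Q (Z ⊗[ℤ] N) :=
  Submodule.span Q
    {x | ∃ (z : Z) (f : F) (n : N), x = (MulOpposite.op f • z) ⊗ₜ[ℤ] n - z ⊗ₜ[ℤ] (f • n)}

/-- The functor `Z ⊗_F - : F-Mod ⥤ Q-Mod` for a `Q`-`F`-bimodule `Z`. -/
noncomputable def balancedTensor : ModuleCat.{u} F ⥤ ModuleCat.{u} Q where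
  obj N := ModuleCat.of Q ((Z ⊗[ℤ] N) ⧸ balancedRelations Q F Z N)
  map {N N'} g := ModuleCat.ofHom <| Submodule.mapQ _ _
    (TensorProduct.AlgebraTensorModule.map (LinearMap.id (R := Q) (M := Z))
      (g.hom.toAddMonoidHom.toIntLinearMap)) <| by
    rw [balancedRelations, Submodule.span_le]
    rintro _ ⟨z, f, n, rfl⟩
    apply Submodule.subset_span
    exact ⟨z, f, g.hom n, by simp⟩
  map_id N := by
    apply ModuleCat.hom_ext
    apply LinearMap.ext
    intro x
    obtain ⟨x, rfl⟩ := Submodule.mkQ_surjective _ x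
    induction x with
    | zero => simp
    | tmul z n => rfl
    | add x y hx hy => rw [map_add, map_add, map_add, hx, hy]
  map_comp g h := by
    apply ModuleCat.hom_ext
    apply LinearMap.ext
    intro x
    obtain ⟨x, rfl⟩ := Submodule.mkQ_surjective _ x
    induction x with
    | zero => simp
    | tmul z n => rfl
    | add x y hx hy => rw [map_add, map_add, map_add, hx, hy]

end BalancedTensor

/-- A functor preserves isoclasses of indecomposables: it maps indecomposable objects to
indecomposable objects, and non-isomorphic indecomposable objects to non-isomorphic objects. -/
def PreservesIsoclassesOfIndecomposables {C D : Type*} [Category C] [Category D]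
    [HasZeroMorphisms C] [HasZeroMorphisms D] [HasBinaryBiproducts C] [HasBinaryBiproducts D]
    (F : C ⥤ D) : Prop :=
  (∀ X : C, Indecomposable X → Indecomposable (F.obj X)) ∧
    ∀ X Y : C, Indecomposable X → Indecomposable Y →
      Nonempty (F.obj X ≅ F.obj Y) → Nonempty (X ≅ Y)

/-- `(𝒜, I)` is wild: there is an `A/I`-`k⟨x, y⟩`-bimodule `Z`, free of finite rank as a right
`k⟨x, y⟩`-module, such that `Z ⊗ -`, followed by the canonical embedding, preserves isoclasses of
indecomposables. -/
def InterlacedWeakDitalgebra.IsWild {k T : Type u} [Field k] [Ring T] [Algebra k T]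
    (𝒜 : InterlacedWeakDitalgebra k T) : Prop :=
  ∃ (Z : Type u) (_ : AddCommGroup Z) (_ : Module 𝒜.QuotAlg Z)
    (_ : Module (FreeAlgebra k (Fin 2))ᵐᵒᵖ Z)
    (_ : SMulCommClass 𝒜.QuotAlg (FreeAlgebra k (Fin 2))ᵐᵒᵖ Z),
    (∀ (c : k) (z : Z), algebraMap k 𝒜.QuotAlg c • z =
      MulOpposite.op (algebraMap k (FreeAlgebra k (Fin 2)) c) • z) ∧
    Module.Free (FreeAlgebra k (Fin 2))ᵐᵒᵖ Z ∧
    Module.Finite (FreeAlgebra k (Fin 2))ᵐᵒᵖ Z ∧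
    PreservesIsoclassesOfIndecomposables
      (balancedTensor 𝒜.QuotAlg (FreeAlgebra k (Fin 2)) Z ⋙ 𝒜.canonicalEmbedding)

/-! Let `Z` be a bimodule witnessing wildness, generated by `n` elements as a right `k⟨x,
y⟩`-module. For each rational function `f ∈ k(t)`, let `x` act on `k(t)` as `t` and `y` as `f`. A
`k⟨x, y⟩`-linear map between two such modules commutes with `t`, hence is `k(t)`-linear, i.e.
multiplication by some `u ∈ k(t)`. So idempotent endomorphisms are `0` or `1`, and an isomorphism
from the module of `f` to that of `g` forces `u f = g u` with `u ≠ 0`, i.e. `f = g`. This is an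
infinite family of pairwise non-isomorphic indecomposables (`RatFuncPair.indecomposable`,
`RatFuncPair.eq_of_linearEquiv`).

By wildness, the modules `Z ⊗ k(t)` form such a family over the ditalgebra. By functoriality the
field `k(t)` acts on each by endomorphisms, and the `n` elements `z ⊗ 1` span it over `k(t)`. Its
endolength is therefore at most `n`, a bound independent of `f` (`tensorRatFunc.endolength_le`). A
nonzero `k(t)`-vector space has infinite dimension over `k` (`tensorRatFunc.not_finiteDimensional`),
so every member is pregeneric. Tameness allows only finitely many isomorphism classes of pregeneric
modules of endolength at most `n`, a contradiction. -/

/-! ### Indecomposability, length and dimension: general facts. -/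

/-- A decomposition `X ≅ Y ⊞ Z` yields the idempotent projecting onto `Y`. If it vanishes then `Y`
is zero, and if it is the identity then `Z` is zero. Idempotents need not split for this direction.
-/
theorem indecomposable_of_idempotent {C : Type*} [Category C] [Preadditive C]
    [HasBinaryBiproducts C] {X : C} (hX : ¬ IsZero X)
    (h : ∀ e : X ⟶ X, e ≫ e = e → e = 0 ∨ e = 𝟙 X) : Indecomposable X := by
  refine ⟨hX, fun Y Z φ => ?_⟩
  have split : ∀ e : Y ⊞ Z ⟶ Y ⊞ Z, e ≫ e = e → e = 0 ∨ e = 𝟙 _ := by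
    intro e he
    have conj : e = φ.inv ≫ (φ.hom ≫ e ≫ φ.inv) ≫ φ.hom := by simp
    rcases h (φ.hom ≫ e ≫ φ.inv) (by simp [reassoc_of% he]) with h | h
    · left
      rw [conj, h]
      simp
    · right
      rw [conj, h]
      simp
  rcases split (biprod.fst ≫ biprod.inl) (by simp) with h | h
  · left
    rw [IsZero.iff_id_eq_zero]
    simpa using biprod.inl ≫= h =≫ biprod.fst
  · right
    rw [IsZero.iff_id_eq_zero]
    simpa using (biprod.inr ≫= h =≫ biprod.snd).symm

/-- Every `S`-submodule is an `R`-submodule, so chains over `S` are chains over `R`. Applied with `R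
= k(t)` and `S` the full endomorphism ring: further endomorphisms can only shorten the module. -/
theorem Module.length_le_of_ringHom {R S M : Type*} [Ring R] [Ring S] [AddCommGroup M]
    [Module R M] [Module S M] (ρ : R →+* S) (h : ∀ (r : R) (m : M), ρ r • m = r • m) :
    Module.length S M ≤ Module.length R M := by
  rw [← WithBot.coe_le_coe, Module.coe_length, Module.coe_length]
  let φ : Submodule S M → Submodule R M := fun p =>
    { p.toAddSubmonoid with
      smul_mem' := fun r m hm => by
        rw [← h]
        exact p.smul_mem _ hm }
  exact Order.krullDim_le_of_strictMono φ fun _ _ hpq => hpq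

theorem Module.length_le_card_of_span_eq_top {K M : Type*} [DivisionRing K] [AddCommGroup M]
    [Module K M] (s : Finset M) (hs : Submodule.span K (s : Set M) = ⊤) :
    Module.length K M ≤ s.card := by
  have : Module.Finite K M := ⟨s, hs⟩
  rw [Module.length_eq_finrank, ← finrank_top, ← hs]
  exact_mod_cast finrank_span_finset_le_card s

theorem RatFunc.not_finiteDimensional (k : Type*) [Field k] :
    ¬ FiniteDimensional k (RatFunc k) := fun _ =>
  Polynomial.not_finite (R := k) <| Module.Finite.of_injective
    (IsScalarTower.toAlgHom k (Polynomial k) (RatFunc k)).toLinearMap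
    (RatFunc.algebraMap_injective k)

/-! ### The family of `k⟨x, y⟩`-modules `k(t)` indexed by `f ∈ k(t)`. -/

section RatFuncPair

variable {k : Type u} [Field k]

/-- The `k⟨x, y⟩`-module `k(t)` on which `x` acts as `t` and `y` acts as `f`. -/
def RatFuncPair (_ : RatFunc k) : Type u := RatFunc k

namespace RatFuncPair

/-- The algebra morphism `k⟨x, y⟩ → k(t)` with `x ↦ t` and `y ↦ f`. -/
noncomputable def eval (f : RatFunc k) : FreeAlgebra k (Fin 2) →ₐ[k] RatFunc k :=
  FreeAlgebra.lift k ![RatFunc.X, f]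

variable (f : RatFunc k)

noncomputable instance : AddCommGroup (RatFuncPair f) := inferInstanceAs (AddCommGroup (RatFunc k))

noncomputable instance : Module (FreeAlgebra k (Fin 2)) (RatFuncPair f) :=
  Module.compHom (RatFunc k) (eval f).toRingHom

/-- The module `k(t)` as an object of the module category. -/
noncomputable abbrev obj : ModuleCat.{u} (FreeAlgebra k (Fin 2)) := ModuleCat.of _ (RatFuncPair f)

/-- The action of `k(t)` on `k(t)` by multiplication is by endomorphisms. -/
noncomputable def mulHom : RatFunc k →+* End (obj f) where
  toFun c := ModuleCat.ofHom
    { toFun := fun x : RatFunc k => (c * x : RatFunc k)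
      map_add' := mul_add (R := RatFunc k) c
      map_smul' := fun a (x : RatFunc k) => mul_left_comm c (eval f a) x }
  map_one' := ModuleCat.hom_ext (LinearMap.ext fun x : RatFunc k => one_mul x)
  map_mul' c d := ModuleCat.hom_ext (LinearMap.ext fun x : RatFunc k => mul_assoc c d x)
  map_zero' := ModuleCat.hom_ext (LinearMap.ext fun x : RatFunc k => zero_mul x)
  map_add' c d := ModuleCat.hom_ext (LinearMap.ext fun x : RatFunc k => add_mul c d x)

/-- The witness is `p(x)`. It does not involve `y`, hence serves for all `g` at once; this is what
makes a morphism between the modules of two different functions `k[t]`-linear. -/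
theorem exists_eval_eq (p : Polynomial k) :
    ∃ a : FreeAlgebra k (Fin 2), ∀ g : RatFunc k, eval g a = algebraMap _ _ p := by
  refine ⟨Polynomial.aeval (FreeAlgebra.ι k 0) p, fun g => ?_⟩
  rw [← Polynomial.aeval_algHom_apply]
  simp [eval]

variable {f} {g : RatFunc k}

/-- A morphism of modules as an additive map `k(t) → k(t)`. -/
noncomputable def toAddMonoidHom
    (φ : RatFuncPair f →ₗ[FreeAlgebra k (Fin 2)] RatFuncPair g) : RatFunc k →+ RatFunc k :=
  LinearMap.toAddMonoidHom φ

theorem toAddMonoidHom_mul (φ : RatFuncPair f →ₗ[FreeAlgebra k (Fin 2)] RatFuncPair g)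
    (a : FreeAlgebra k (Fin 2)) (x : RatFunc k) :
    toAddMonoidHom φ (eval f a * x) = eval g a * toAddMonoidHom φ x :=
  φ.map_smul a x

/-- A morphism is determined by the image of `1`. -/
theorem toAddMonoidHom_apply (φ : RatFuncPair f →ₗ[FreeAlgebra k (Fin 2)] RatFuncPair g)
    (x : RatFunc k) : toAddMonoidHom φ x = x * toAddMonoidHom φ 1 := by
  have poly : ∀ (p : Polynomial k) (y : RatFunc k),
      toAddMonoidHom φ (algebraMap _ (RatFunc k) p * y) =
        algebraMap _ (RatFunc k) p * toAddMonoidHom φ y := by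
    intro p y
    obtain ⟨a, ha⟩ := exists_eval_eq p
    simpa only [ha] using toAddMonoidHom_mul φ a y
  induction x using RatFunc.induction_on with
  | f p q hq =>
    have hq' : algebraMap _ (RatFunc k) q ≠ 0 := by simpa using hq
    -- Linearity over `k[t]` passes to fractions `p / q` by clearing the denominator.
    apply mul_left_cancel₀ hq'
    rw [← poly, mul_div_cancel₀ _ hq', ← mul_assoc, mul_div_cancel₀ _ hq', ← poly, mul_one]

/-- With `u` the image of `1`, compatibility with `y` reads `f u = g u`, and `u ≠ 0` by injectivity.
-/
theorem eq_of_linearEquiv (e : RatFuncPair f ≃ₗ[FreeAlgebra k (Fin 2)] RatFuncPair g) :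
    f = g := by
  have h := toAddMonoidHom_mul e.toLinearMap (FreeAlgebra.ι k 1) 1
  rw [toAddMonoidHom_apply] at h
  have hι : ∀ h : RatFunc k, eval h (FreeAlgebra.ι k 1) = h := fun h => by simp [eval]
  rw [hι, hι, mul_one] at h
  have h0 : toAddMonoidHom e.toLinearMap 1 ≠ 0 := fun h0 =>
    one_ne_zero (α := RatFunc k) (e.map_eq_zero_iff.1 h0)
  exact mul_right_cancel₀ h0 h

/-- An idempotent endomorphism is multiplication by an idempotent of the field `k(t)`, hence by `0`
or `1`. -/
theorem indecomposable (f : RatFunc k) : Indecomposable (obj f) := by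
  apply indecomposable_of_idempotent
  · intro h
    have := ModuleCat.subsingleton_of_isZero h
    exact one_ne_zero (α := RatFunc k) (this.elim (α := RatFuncPair f) _ _)
  · intro e he
    have hx := toAddMonoidHom_apply e.hom
    have hcc : toAddMonoidHom e.hom 1 * toAddMonoidHom e.hom 1 = toAddMonoidHom e.hom 1 := by
      rw [← hx]
      exact LinearMap.congr_fun (congrArg ModuleCat.Hom.hom he) (1 : RatFunc k)
    rcases IsIdempotentElem.iff_eq_zero_or_one.1 hcc with h | h
    · left
      apply ModuleCat.hom_ext
      apply LinearMap.ext
      intro x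
      refine (hx x).trans ?_
      rw [h]
      exact mul_zero (M₀ := RatFunc k) x
    · right
      apply ModuleCat.hom_ext
      apply LinearMap.ext
      intro x
      refine (hx x).trans ?_
      rw [h]
      exact mul_one (M := RatFunc k) x

end RatFuncPair

end RatFuncPair

/-! ### Additivity of the functors, so that they induce ring morphisms on endomorphisms. -/

instance balancedTensor_additive (Q F : Type u) [Ring Q] [Ring F] (Z : Type u) [AddCommGroup Z]
    [Module Q Z] [Module Fᵐᵒᵖ Z] : (balancedTensor Q F Z).Additive where
  map_add {N N' f g} := by
    apply ModuleCat.hom_ext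
    apply LinearMap.ext
    intro x
    obtain ⟨x, rfl⟩ := Submodule.mkQ_surjective _ x
    -- It suffices to check the identity in `Z ⊗_ℤ N'`, before dividing by the balancing relations.
    refine (congrArg (balancedRelations Q F Z N').mkQ ?_).trans (map_add _ _ _)
    induction x with
    | zero => rw [map_zero, map_zero, map_zero, add_zero]
    | tmul z n => exact TensorProduct.tmul_add z (f.hom n) (g.hom n)
    | add x y hx hy =>
      rw [map_add, map_add, map_add, hx, hy]
      abel

namespace InterlacedWeakDitalgebra

variable {k T : Type u} [Field k] [Ring T] [Algebra k T] (𝒜 : InterlacedWeakDitalgebra k T)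

instance canonicalEmbedding_additive : 𝒜.canonicalEmbedding.Additive where
  map_add := Mod.hom_ext (fun _ => rfl) fun _ _ => (add_zero _).symm

/-! ### The modules `Z ⊗ k(t)`: endolength and dimension. -/

variable (Z : Type u) [AddCommGroup Z] [Module 𝒜.QuotAlg Z] [Module (FreeAlgebra k (Fin 2))ᵐᵒᵖ Z]

/-- The object `Z ⊗ k(t)`, where `x` and `y` act on `k(t)` as `t` and `f`. -/
noncomputable def tensorRatFunc (f : RatFunc k) : 𝒜.Mod :=
  (balancedTensor 𝒜.QuotAlg (FreeAlgebra k (Fin 2)) Z ⋙ 𝒜.canonicalEmbedding).obj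
    (RatFuncPair.obj f)

namespace tensorRatFunc

variable {Z} {𝒜} {f : RatFunc k}

/-- The pure tensor `z ⊗ x`. -/
noncomputable def tmul (f : RatFunc k) (z : Z) (x : RatFunc k) : 𝒜.tensorRatFunc Z f :=
  (balancedRelations 𝒜.QuotAlg (FreeAlgebra k (Fin 2)) Z (RatFuncPair f)).mkQ (z ⊗ₜ[ℤ] x)

theorem tmul_smul (z : Z) (a : FreeAlgebra k (Fin 2)) (x : RatFunc k) :
    (tmul f (MulOpposite.op a • z) x : 𝒜.tensorRatFunc Z f) =
      tmul f z (RatFuncPair.eval f a * x) :=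
  (Submodule.Quotient.eq _).2 (Submodule.subset_span ⟨z, a, x, rfl⟩)

theorem add_tmul (z z' : Z) (x : RatFunc k) :
    (tmul f (z + z') x : 𝒜.tensorRatFunc Z f) = tmul f z x + tmul f z' x :=
  congrArg (balancedRelations 𝒜.QuotAlg (FreeAlgebra k (Fin 2)) Z (RatFuncPair f)).mkQ
    (TensorProduct.add_tmul z z' (show RatFuncPair f from x))

theorem zero_tmul (x : RatFunc k) : (tmul f (0 : Z) x : 𝒜.tensorRatFunc Z f) = 0 :=
  congrArg (balancedRelations 𝒜.QuotAlg (FreeAlgebra k (Fin 2)) Z (RatFuncPair f)).mkQ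
    (TensorProduct.zero_tmul Z (show RatFuncPair f from x))

theorem induction_on {p : 𝒜.tensorRatFunc Z f → Prop} (m : 𝒜.tensorRatFunc Z f)
    (zero : p 0) (tmul : ∀ z x, p (tmul f z x)) (add : ∀ x y, p x → p y → p (x + y)) : p m := by
  obtain ⟨x, rfl⟩ := Submodule.mkQ_surjective
    (balancedRelations 𝒜.QuotAlg (FreeAlgebra k (Fin 2)) Z (RatFuncPair f)) m
  induction x with
  | zero =>
    rw [map_zero]
    exact zero
  | tmul z n => exact tmul z n
  | add x y hx hy =>
    rw [map_add]
    exact add _ _ hx hy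

/-- `k(t)` acts on `Z ⊗ k(t)` by endomorphisms. -/
noncomputable def endHom (f : RatFunc k) : RatFunc k →+* End (𝒜.tensorRatFunc Z f) :=
  { (Functor.mapEnd (RatFuncPair.obj f)
        (balancedTensor 𝒜.QuotAlg (FreeAlgebra k (Fin 2)) Z ⋙ 𝒜.canonicalEmbedding)).comp
      (RatFuncPair.mulHom f).toMonoidHom with
    map_zero' := by
      change (balancedTensor 𝒜.QuotAlg (FreeAlgebra k (Fin 2)) Z ⋙ 𝒜.canonicalEmbedding).map
        (RatFuncPair.mulHom f 0) = 0
      rw [map_zero]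
      exact Functor.map_zero _ _ _
    map_add' := fun c d => by
      change (balancedTensor 𝒜.QuotAlg (FreeAlgebra k (Fin 2)) Z ⋙ 𝒜.canonicalEmbedding).map
        (RatFuncPair.mulHom f (c + d)) = _
      rw [map_add]
      exact Functor.map_add _ }

noncomputable instance : Module (RatFunc k) (𝒜.tensorRatFunc Z f) :=
  Module.compHom _ (endHom f : _ →+* End (𝒜.tensorRatFunc Z f))

theorem endHom_smul (c : RatFunc k) (m : 𝒜.tensorRatFunc Z f) : (endHom f c : End (𝒜.tensorRatFunc Z f)) • m = c • m := rfl

theorem smul_tmul (c : RatFunc k) (z : Z) (x : RatFunc k) :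
    c • (tmul f z x : 𝒜.tensorRatFunc Z f) = tmul f z (c * x) := rfl

/-- Right scalars on `Z` move across the tensor sign and become elements of `k(t)`, so generators of
`Z` over `k⟨x, y⟩` give generators over `k(t)`. -/
theorem span_tmul_one (s : Set Z)
    (hs : Submodule.span (FreeAlgebra k (Fin 2))ᵐᵒᵖ s = ⊤) :
    Submodule.span (RatFunc k) ((fun z => (tmul f z 1 : 𝒜.tensorRatFunc Z f)) '' s) = ⊤ := by
  rw [eq_top_iff]
  rintro m -
  induction m using induction_on with
  | zero => exact Submodule.zero_mem _
  | add x y hx hy => exact Submodule.add_mem _ hx hy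
  | tmul z x =>
    have hz : z ∈ Submodule.span (FreeAlgebra k (Fin 2))ᵐᵒᵖ s := hs ▸ Submodule.mem_top
    -- The second factor must stay arbitrary, since the scalar case replaces `x` by `eval f a * x`.
    induction hz using Submodule.span_induction generalizing x with
    | mem z hz =>
      have := Submodule.smul_mem _ x (Submodule.subset_span (R := RatFunc k)
        (Set.mem_image_of_mem (fun z => (tmul f z 1 : 𝒜.tensorRatFunc Z f)) hz))
      simpa only [smul_tmul, mul_one] using this
    | zero =>
      rw [zero_tmul]
      exact Submodule.zero_mem _
    | add z z' _ _ h h' =>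
      rw [add_tmul]
      exact Submodule.add_mem _ (h x) (h' x)
    | smul a z _ h =>
      rw [← MulOpposite.op_unop a, tmul_smul]
      exact h _

/-- The endolength is at most the length over `k(t)`, which is a dimension, hence at most the number
of generators. The bound is the same for all `f`. -/
theorem endolength_le (s : Finset Z)
    (hs : Submodule.span (FreeAlgebra k (Fin 2))ᵐᵒᵖ (s : Set Z) = ⊤) :
    (𝒜.tensorRatFunc Z f).endolength ≤ s.card := by
  classical
  refine (Module.length_le_of_ringHom (endHom f) endHom_smul).trans <|
    (Module.length_le_card_of_span_eq_top
      (s.image fun z => (tmul f z 1 : 𝒜.tensorRatFunc Z f)) ?_).trans ?_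
  · rw [Finset.coe_image]
    exact span_tmul_one _ hs
  · exact_mod_cast Finset.card_image_le

/-- The field `k` acts in two ways: through `A/I` on the factor `Z`, and through `k(t)` on the other
factor. They agree because the left and right actions of `k` on `Z` coincide. -/
theorem algebraMap_smul
    (hk : ∀ (c : k) (z : Z), algebraMap k 𝒜.QuotAlg c • z =
      MulOpposite.op (algebraMap k (FreeAlgebra k (Fin 2)) c) • z)
    (c : k) (m : 𝒜.tensorRatFunc Z f) : algebraMap k (RatFunc k) c • m = c • m := by
  induction m using induction_on with
  | zero => rw [smul_zero, smul_zero]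
  | add x y hx hy => rw [smul_add, smul_add, hx, hy]
  | tmul z x =>
    have : c • (tmul f z x : 𝒜.tensorRatFunc Z f) = tmul f (algebraMap k 𝒜.QuotAlg c • z) x := rfl
    rw [this, hk, tmul_smul, smul_tmul, AlgHom.commutes]

/-- For `m ≠ 0`, the map `c ↦ c • m` is a `k`-linear embedding of the infinite-dimensional space
`k(t)`. -/
theorem not_finiteDimensional
    (hk : ∀ (c : k) (z : Z), algebraMap k 𝒜.QuotAlg c • z =
      MulOpposite.op (algebraMap k (FreeAlgebra k (Fin 2)) c) • z)
    (h : ¬ IsZero (𝒜.tensorRatFunc Z f)) : ¬ FiniteDimensional k (𝒜.tensorRatFunc Z f) := by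
  intro _
  have : IsScalarTower k (RatFunc k) (𝒜.tensorRatFunc Z f) := ⟨fun c x m => by
    rw [Algebra.smul_def, mul_smul, algebraMap_smul hk]⟩
  obtain ⟨m, hm⟩ : ∃ m : 𝒜.tensorRatFunc Z f, m ≠ 0 := by
    by_contra! h0
    -- If the underlying space is zero, so is the object: the identity is `(id, 0)`, and its second
    -- component vanishes anyway.
    refine h ((IsZero.iff_id_eq_zero _).2 (Mod.hom_ext h0 fun _ _ => rfl))
  exact RatFunc.not_finiteDimensional k <| Module.Finite.of_injective
    ((LinearMap.toSpanSingleton (RatFunc k) _ m).restrictScalars k)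
    (LinearMap.ker_eq_bot.1 (by
      rw [LinearMap.ker_restrictScalars, LinearMap.ker_toSpanSingleton _ hm]
      rfl))

end tensorRatFunc

end InterlacedWeakDitalgebra

/-! ### The contradiction between tameness and wildness. -/

theorem propositionP {k T : Type u} [Field k] [Ring T] [Algebra k T]
    (𝒜 : InterlacedWeakDitalgebra k T) (triangular : 𝒜.IsTriangular)
    (tame : 𝒜.PregenericallyTame) : ¬ 𝒜.IsWild := by
  rintro ⟨Z, _, _, _, _, hk, -, ⟨s, hs⟩, indec, iso⟩
  choose S S_fin hS using tame
  -- Tameness treats one endolength at a time; the uniform bound `s.card` leaves only finitely many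
  -- values of `d`, so a single finite set of representatives suffices.
  have key : ∀ f : RatFunc k, ∃ N ∈ ⋃ d ∈ Set.Iic s.card, S d,
      Nonempty (𝒜.tensorRatFunc Z f ≅ N) := by
    intro f
    have hf : Indecomposable (𝒜.tensorRatFunc Z f) := indec _ (RatFuncPair.indecomposable f)
    have hle := InterlacedWeakDitalgebra.tensorRatFunc.endolength_le (𝒜 := 𝒜) (f := f) s hs
    have htop : (𝒜.tensorRatFunc Z f).endolength ≠ ⊤ := ne_top_of_le_ne_top (by simp) hle
    obtain ⟨d, hd⟩ := ENat.ne_top_iff_exists.1 htop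
    obtain ⟨N, hN, e⟩ := hS d _
      ⟨hf, htop, InterlacedWeakDitalgebra.tensorRatFunc.not_finiteDimensional hk hf.1⟩ hd.symm
    rw [← hd] at hle
    exact ⟨N, Set.mem_biUnion (Set.mem_Iic.2 (by exact_mod_cast hle)) hN, e⟩
  choose N hN e using key
  -- Indexing by `k(t)` rather than by `k` keeps the family infinite even when `k` is finite.
  have : Infinite (RatFunc k) := Infinite.of_injective _ (RatFunc.algebraMap_injective k)
  -- By the pigeonhole principle, two distinct functions share a representative, so their tensor
  -- products are isomorphic.
  obtain ⟨f, -, g, -, hfg, h⟩ := Set.infinite_univ.exists_ne_map_eq_of_mapsTo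
    (fun f _ => hN f) ((Set.finite_Iic s.card).biUnion fun d _ => S_fin d)
  obtain ⟨e₁⟩ := e f
  obtain ⟨e₂⟩ := e g
  obtain ⟨φ⟩ := iso _ _ (RatFuncPair.indecomposable f) (RatFuncPair.indecomposable g)
    ⟨e₁ ≪≫ eqToIso h ≪≫ e₂.symm⟩
  exact hfg (RatFuncPair.eq_of_linearEquiv φ.toLinearEquiv)
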